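/- **Universal approximation with signatures.** Let $V$ be a finite-dimensional real normed space, let $1\le p<2$, and let $[a,b]$ be a closed interval. Let $C_{0,p}(V)$ be the set of continuous paths $x:[a,b]\to V$ with $x_a=0$ and finite $p$-variation. For $x\in C_{0,p}(V)$ the signature is $$S(x)=\bigl(1,S(x)^{(1)},S(x)^{(2)},\dots\bigr)\in T((V)):=\prod_{k\ge 0}V^{\otimes k},\qquad S(x)^{(k)}=\int_{a<t_1<\dots<t_k<b}dx_{t_1}\otimes\cdots\otimes dx_{t_k},$$ where the iterated integrals are Young integrals. Let $\mathcal C_p:=C_{0,p}(V)/\!\sim$ be the space of unparameterised paths, where $x\sim y$ if and only if $S(x)=S(y)$. Let $T(V^*):=\bigoplus_{k\ge0}(V^*)^{\otimes k}$ act on $T((V))$ through the canonical pairing $(f,A)=\sum_k f_k(A_k)$, a finite sum, and for $f\in T(V^*)$ put $\Phi_f:\mathcal C_p\to\mathbb R$, $\Phi_f([x])=(f,S(x))$. Equip $\mathcal C_p$ with an arbitrary topology and let $K\subset\mathcal C_p$ be compact. Let $C(K)$ be the space of continuous functions $K\to\mathbb R$ with the topology of uniform convergence. If $\Phi_f|_K$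 is continuous for every $f\in T(V^*)$, then $\{\Phi_f|_K : f\in T(V^*)\}$ is a dense subset of $C(K)$. -/

import Mathlib

open Set
open scoped TensorProduct DirectSum ENNReal

noncomputable section

namespace PathSignature

/-! ### Young (Riemann–Stieltjes) integration -/

/-- `u 0 ≤ u 1 ≤ … ≤ u n` is a partition of `[s, t]` of mesh smaller than `δ`, and
`ξ i ∈ [u i, u (i + 1)]` are tags for it (only the indices up to `n` matter for the data). -/
structure IsTaggedPartition (s t δ : ℝ) (n : ℕ) (u ξ : ℕ → ℝ) : Prop where
  mono : Monotone u
  left : u 0 = s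
  right : u n = t
  mesh : ∀ i < n, u (i + 1) - u i < δ
  tag : ∀ i < n, ξ i ∈ Icc (u i) (u (i + 1))

section Young

variable {E F G : Type*} [AddCommGroup E] [Module ℝ E] [AddCommGroup F] [Module ℝ F]
  [AddCommGroup G] [Module ℝ G]

/-- The Riemann–Stieltjes sum `∑ i < n, B (f (ξ i)) (g (u (i + 1)) - g (u i))`, where the integrand
and the increments of the integrator are multiplied through the bilinear map `B`. -/
def youngSum (B : E →ₗ[ℝ] F →ₗ[ℝ] G) (f : ℝ → E) (g : ℝ → F) (n : ℕ) (u ξ : ℕ → ℝ) : G :=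
  ∑ i ∈ Finset.range n, B (f (ξ i)) (g (u (i + 1)) - g (u i))

/-- `I` is the Young integral `∫ r in s..t, B (f r) (dg r)`: the tagged Riemann–Stieltjes sums over
`[s, t]` converge to `I` as the mesh tends to zero. The space `G` will be finite-dimensional; its
unique Hausdorff vector space topology (that of any norm) is the one in which a family converges as
soon as it converges after applying each linear functional. -/
def HasYoungIntegral (B : E →ₗ[ℝ] F →ₗ[ℝ] G) (f : ℝ → E) (g : ℝ → F) (s t : ℝ) (I : G) : Prop :=
  ∀ φ : Module.Dual ℝ G, ∀ ε > 0, ∃ δ > 0, ∀ (n : ℕ) (u ξ : ℕ → ℝ),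
    IsTaggedPartition s t δ n u ξ → |φ (youngSum B f g n u ξ) - φ I| < ε

open Classical in
/-- The Young integral `∫ r in s..t, B (f r) (dg r)` (with value `0` if it does not exist). -/
def youngIntegral (B : E →ₗ[ℝ] F →ₗ[ℝ] G) (f : ℝ → E) (g : ℝ → F) (s t : ℝ) : G :=
  if h : ∃ I, HasYoungIntegral B f g s t I then h.choose else 0

/-- Partitions of arbitrarily small mesh exist. -/
theorem exists_isTaggedPartition {s t δ : ℝ} (hst : s ≤ t) (hδ : 0 < δ) :
    ∃ n u ξ, IsTaggedPartition s t δ n u ξ := by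
  obtain ⟨n, hn⟩ := exists_nat_gt ((t - s) / δ)
  have hn0 : (0 : ℝ) < n := lt_of_le_of_lt (div_nonneg (sub_nonneg.2 hst) hδ.le) hn
  refine ⟨n, fun i => s + i * ((t - s) / n), fun i => s + i * ((t - s) / n), ?_, ?_, ?_, ?_, ?_⟩
  · intro i j hij
    have h : (i : ℝ) ≤ j := by exact_mod_cast hij
    have h2 : 0 ≤ (t - s) / n := div_nonneg (sub_nonneg.2 hst) hn0.le
    have := mul_le_mul_of_nonneg_right h h2
    simpa using this
  · simp
  · field_simp
    ring
  · intro i _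
    rw [div_lt_iff₀ hδ] at hn
    have : (t - s) / n < δ := by rw [div_lt_iff₀ hn0]; linarith
    push_cast
    linarith
  · intro i _
    have h2 : 0 ≤ (t - s) / n := div_nonneg (sub_nonneg.2 hst) hn0.le
    refine ⟨le_rfl, ?_⟩
    push_cast
    linarith

/-- The Young integral is unique. -/
theorem HasYoungIntegral.unique {B : E →ₗ[ℝ] F →ₗ[ℝ] G} {f : ℝ → E} {g : ℝ → F} {s t : ℝ}
    (hst : s ≤ t) {I J : G} (hI : HasYoungIntegral B f g s t I)
    (hJ : HasYoungIntegral B f g s t J) : I = J := by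
  rw [← sub_eq_zero, ← Module.forall_dual_apply_eq_zero_iff ℝ]
  intro φ
  by_contra hne
  have hε : 0 < |φ (I - J)| / 2 := half_pos (abs_pos.2 hne)
  obtain ⟨δ₁, h₁, H₁⟩ := hI φ _ hε
  obtain ⟨δ₂, h₂, H₂⟩ := hJ φ _ hε
  obtain ⟨n, u, ξ, h⟩ := exists_isTaggedPartition hst (lt_min h₁ h₂)
  have a := H₁ n u ξ ⟨h.mono, h.left, h.right,
    fun i hi => (h.mesh i hi).trans_le (min_le_left _ _), h.tag⟩
  have b := H₂ n u ξ ⟨h.mono, h.left, h.right,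
    fun i hi => (h.mesh i hi).trans_le (min_le_right _ _), h.tag⟩
  have e : φ (I - J) = (φ (youngSum B f g n u ξ) - φ J) - (φ (youngSum B f g n u ξ) - φ I) := by
    rw [map_sub]; ring
  have := abs_sub (φ (youngSum B f g n u ξ) - φ J) (φ (youngSum B f g n u ξ) - φ I)
  rw [← e] at this
  linarith

theorem HasYoungIntegral.youngIntegral_eq {B : E →ₗ[ℝ] F →ₗ[ℝ] G} {f : ℝ → E} {g : ℝ → F}
    {s t : ℝ} (hst : s ≤ t) {I : G} (hI : HasYoungIntegral B f g s t I) :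
    youngIntegral B f g s t = I := by
  have h : ∃ I, HasYoungIntegral B f g s t I := ⟨I, hI⟩
  rw [youngIntegral, dif_pos h]
  exact h.choose_spec.unique hst hI

end Young

/-! ### Tensors and the signature -/

section Tensors

variable (V : Type*) [AddCommGroup V] [Module ℝ V]

/-- The space of formal tensor series `T((V)) = ∏ k, V^{⊗k}`. -/
abbrev TensorSeries : Type _ := (k : ℕ) → ⨂[ℝ]^k V

/-- The space `T(V*) = ⨁ k, (V*)^{⊗k}` of tensor polynomials over the dual space. -/
abbrev CoTensor : Type _ := ⨁ k : ℕ, ⨂[ℝ]^k (Module.Dual ℝ V)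

variable {V}

/-- The canonical pairing `T(V*) × T((V)) → ℝ`, `(f, A) ↦ ∑ k, f_k (A_k)` (a finite sum), where
`(V*)^{⊗k}` acts on `V^{⊗k}` by `(φ₁ ⊗ ⋯ ⊗ φ_k) (v₁ ⊗ ⋯ ⊗ v_k) = ∏ i, φ_i (v_i)`. Through it `T(V*)`
is the dual space of `T((V))`. -/
def pairing : CoTensor V →ₗ[ℝ] Module.Dual ℝ (TensorSeries V) :=
  DirectSum.toModule ℝ ℕ _ fun k =>
    (LinearMap.lcomp ℝ ℝ (LinearMap.proj k : TensorSeries V →ₗ[ℝ] ⨂[ℝ]^k V)) ∘ₗ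
      TensorPower.pairingDual ℝ V k

theorem pairing_of (k : ℕ) (f : ⨂[ℝ]^k (Module.Dual ℝ V)) (A : TensorSeries V) :
    pairing (DirectSum.lof ℝ ℕ (fun k => ⨂[ℝ]^k (Module.Dual ℝ V)) k f) A =
      TensorPower.pairingDual ℝ V k f (A k) := by
  rw [pairing, DirectSum.toModule_lof]
  rfl

/-- The tensor product `V^{⊗k} × V → V^{⊗(k+1)}`. -/
def tensorSnoc (k : ℕ) : ⨂[ℝ]^k V →ₗ[ℝ] V →ₗ[ℝ] ⨂[ℝ]^(k + 1) V :=
  ((TensorProduct.mk ℝ (⨂[ℝ]^k V) (⨂[ℝ]^1 V)).compr₂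
    (TensorPower.mulEquiv (R := ℝ) (M := V) (n := k) (m := 1)).toLinearMap).compl₂
    (PiTensorProduct.subsingletonEquiv (R := ℝ) (s := fun _ : Fin 1 => V) 0).symm.toLinearMap

theorem tensorSnoc_tprod (k : ℕ) (v : Fin k → V) (w : V) :
    tensorSnoc k (PiTensorProduct.tprod ℝ v) w =
      PiTensorProduct.tprod ℝ (Fin.snoc v w : Fin (k + 1) → V) := by
  have := TensorPower.tprod_mul_tprod (R := ℝ) v (fun _ : Fin 1 => w)
  rw [Fin.append_right_eq_snoc] at this
  rw [← this, TensorPower.gMul_def]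
  simp [tensorSnoc]

/-- The iterated integral `∫_{a < t₁ < ⋯ < t_k < t} dx_{t₁} ⊗ ⋯ ⊗ dx_{t_k} ∈ V^{⊗k}`, by recursion on
`k`: it is `1` for `k = 0`, and the integral at level `k + 1` up to time `t` is the Young integral
over `s ∈ [a, t]` of the one at level `k` up to time `s`, tensored with `dx_s`. -/
def iteratedIntegral (x : ℝ → V) (a : ℝ) : (k : ℕ) → ℝ → ⨂[ℝ]^k V
  | 0 => fun _ => PiTensorProduct.tprod ℝ Fin.elim0
  | k + 1 => fun t => youngIntegral (tensorSnoc k) (iteratedIntegral x a k) x a t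

end Tensors

/-! ### Paths of finite `p`-variation and unparameterised paths -/

section Paths

variable {V : Type*} [NormedAddCommGroup V] [NormedSpace ℝ V]

/-- The `p`-variation of a path on `[a, b]`, as an extended nonnegative real. -/
def pVariation (p : ℝ) {a b : ℝ} (x : Icc a b → V) : ℝ≥0∞ :=
  (⨆ q : ℕ × { u : ℕ → Icc a b // Monotone u },
    ∑ i ∈ Finset.range q.1, ‖x (q.2.1 (i + 1)) - x (q.2.1 i)‖ₑ ^ p) ^ (1 / p)

variable (V) in
/-- `C_{0,p}([a, b], V)`: the continuous paths `[a, b] → V` of finite `p`-variation that start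
at `0`. -/
def Path₀ (p : ℝ) {a b : ℝ} (hab : a ≤ b) : Type _ :=
  { x : C(Icc a b, V) // pVariation p x < ∞ ∧ x ⟨a, left_mem_Icc.2 hab⟩ = 0 }

/-- The signature `S(x) = (1, S(x)^{(1)}, S(x)^{(2)}, …) ∈ T((V))` of a path on `[a, b]`. (The path is
extended to `ℝ` by constants; only its values on `[a, b]` enter.) -/
def signature {p a b : ℝ} {hab : a ≤ b} (x : Path₀ V p hab) : TensorSeries V :=
  fun k => iteratedIntegral (IccExtend hab x.1) a k b

variable (V) in
/-- Two paths are equivalent if they have the same signature. -/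
def sigSetoid (p : ℝ) {a b : ℝ} (hab : a ≤ b) : Setoid (Path₀ V p hab) :=
  Setoid.ker signature

variable (V) in
/-- The space `𝒞_p` of `p`-unparameterised paths. -/
def UnparamPath (p : ℝ) {a b : ℝ} (hab : a ≤ b) : Type _ :=
  Quotient (sigSetoid V p hab)

/-- The function `Φ_f : [x] ↦ (f, S(x))` on unparameterised paths. -/
def sigFunctional {p a b : ℝ} {hab : a ≤ b} (f : CoTensor V) (γ : UnparamPath V p hab) : ℝ :=
  Quotient.lift (fun x : Path₀ V p hab => pairing f (signature x))
    (fun _ _ h => congrArg (pairing f) h) γ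

end Paths

end PathSignature

end

/-!
The density follows from the Stone–Weierstrass theorem, once the functions `Φ_f` are known to separate
points and to form an algebra.

They separate points because unparameterised paths are distinguished by their signatures, and because
in finite dimension `(V*)^{⊗k}` is the whole dual space of `V^{⊗k}` (`exists_pairing_ne`).

They form an algebra by the shuffle identity (`exists_pairing_signature_mul`), which is a form of
integration by parts. Write `X_f(t)` for the pairing of `f` with the signature over `[a, t]`. Then
`dX_{f ⊗ φ} = X_f d(φ ∘ x)`, so the Leibniz rule gives
`d(X_{f ⊗ φ} X_{g ⊗ ψ}) = X_{f ⊗ φ} X_g d(ψ ∘ x) + X_f X_{g ⊗ ψ} d(φ ∘ x)`,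
and by induction on the lengths of the words the products on the right are some `X_{h₁}` and `X_{h₂}`.
Hence `X_{f ⊗ φ} X_{g ⊗ ψ} = X_h` with `h = h₁ ⊗ ψ + h₂ ⊗ φ`, which does not depend on `x`.

Differentials are made precise through a control `ω` of the path, a superadditive function of
intervals which is small on short ones. A path of finite `p`-variation with `p < 2` has increments of
order `ω ^ (θ / 2)` for some `θ > 1` (`exists_incrOfOrder`). An identity of differentials is an identity
of increments up to `O(ω ^ θ)`; it determines a function up to a constant (`eq_of_ofOrder`), and the
product of two increments is negligible, which yields the Leibniz rule. The Young integrals that define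
the signature exist by the sewing lemma (`IsControl.exists_sewing`), and they are primitives in this
sense (`iteratedIntegral_succ`).
-/

namespace PathSignature

open Filter Topology Asymptotics

/-! ### Controls and sewing -/

/-- A control on `[a, b]`: a nonnegative superadditive function of the subintervals `[s, t]` which
tends to zero uniformly with their length. Nothing is asked of `ω` at other arguments. -/
structure IsControl (a b : ℝ) (ω : ℝ → ℝ → ℝ) : Prop where
  nonneg : ∀ ⦃s t⦄, a ≤ s → s ≤ t → t ≤ b → 0 ≤ ω s t
  superadd : ∀ ⦃s u t⦄, a ≤ s → s ≤ u → u ≤ t → t ≤ b → ω s u + ω u t ≤ ω s t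
  small : ∀ ε > 0, ∃ δ > 0, ∀ ⦃s t⦄, a ≤ s → s ≤ t → t ≤ b → t - s < δ → ω s t < ε

/-- `Ξ` is of order `r` with respect to `ω` on `[a, b]`: `Ξ s t = O(ω s t ^ r)`, uniformly over the
subintervals `[s, t]` of `[a, b]`. -/
def OfOrder (a b : ℝ) (ω : ℝ → ℝ → ℝ) (r : ℝ) (Ξ : ℝ → ℝ → ℝ) : Prop :=
  (fun z : ℝ × ℝ => Ξ z.1 z.2) =O[𝓟 {z : ℝ × ℝ | a ≤ z.1 ∧ z.1 ≤ z.2 ∧ z.2 ≤ b}]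
    fun z => ω z.1 z.2 ^ r

section Control

variable {a b : ℝ} {ω : ℝ → ℝ → ℝ} {r θ : ℝ} {Ξ : ℝ → ℝ → ℝ}

theorem IsControl.mono (hω : IsControl a b ω) {s s' t' t : ℝ} (h₁ : a ≤ s) (h₂ : s ≤ s')
    (h₃ : s' ≤ t') (h₄ : t' ≤ t) (h₅ : t ≤ b) : ω s' t' ≤ ω s t := by
  have e₁ := hω.superadd h₁ h₂ (h₃.trans h₄) h₅
  have e₂ := hω.superadd (h₁.trans h₂) h₃ h₄ h₅
  have e₃ := hω.nonneg h₁ h₂ ((h₃.trans h₄).trans h₅)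
  have e₄ := hω.nonneg (h₁.trans (h₂.trans h₃)) h₄ h₅
  linarith

theorem IsControl.ofOrder_iff (hω : IsControl a b ω) :
    OfOrder a b ω r Ξ ↔
      ∃ C, 0 ≤ C ∧ ∀ ⦃s t⦄, a ≤ s → s ≤ t → t ≤ b → |Ξ s t| ≤ C * ω s t ^ r := by
  rw [OfOrder, isBigO_principal]
  constructor
  · rintro ⟨c, hc⟩
    refine ⟨max c 0, le_max_right _ _, fun s t h₁ h₂ h₃ => ?_⟩
    have h := hc (s, t) ⟨h₁, h₂, h₃⟩
    have h0 := Real.rpow_nonneg (hω.nonneg h₁ h₂ h₃) r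
    rw [Real.norm_eq_abs, Real.norm_eq_abs, abs_of_nonneg h0] at h
    exact h.trans (mul_le_mul_of_nonneg_right (le_max_left _ _) h0)
  · rintro ⟨c, -, hc⟩
    refine ⟨c, fun z hz => ?_⟩
    have h0 := Real.rpow_nonneg (hω.nonneg hz.1 hz.2.1 hz.2.2) r
    rw [Real.norm_eq_abs, Real.norm_eq_abs, abs_of_nonneg h0]
    exact hc hz.1 hz.2.1 hz.2.2

theorem OfOrder.congr {Ξ' : ℝ → ℝ → ℝ} (h : OfOrder a b ω r Ξ)
    (he : ∀ ⦃s t⦄, a ≤ s → s ≤ t → t ≤ b → Ξ s t = Ξ' s t) : OfOrder a b ω r Ξ' :=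
  IsBigO.congr' h (eventually_principal.2 fun _ hz => he hz.1 hz.2.1 hz.2.2) EventuallyEq.rfl

theorem OfOrder.add {Ξ' : ℝ → ℝ → ℝ} (h : OfOrder a b ω r Ξ) (h' : OfOrder a b ω r Ξ') :
    OfOrder a b ω r fun s t => Ξ s t + Ξ' s t :=
  IsBigO.add h h'

theorem OfOrder.sub {Ξ' : ℝ → ℝ → ℝ} (h : OfOrder a b ω r Ξ) (h' : OfOrder a b ω r Ξ') :
    OfOrder a b ω r fun s t => Ξ s t - Ξ' s t :=
  IsBigO.sub h h'

theorem OfOrder.zero : OfOrder a b ω r fun _ _ => 0 :=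
  isBigO_zero _ _

theorem OfOrder.const_mul (c : ℝ) (h : OfOrder a b ω r Ξ) :
    OfOrder a b ω r fun s t => c * Ξ s t :=
  IsBigO.const_mul_left h c

theorem OfOrder.sum {ι : Type*} {S : Finset ι} {Ξ : ι → ℝ → ℝ → ℝ}
    (h : ∀ i ∈ S, OfOrder a b ω r (Ξ i)) : OfOrder a b ω r fun s t => ∑ i ∈ S, Ξ i s t :=
  IsBigO.fun_sum h

/-- The control is bounded on `[a, b]`, so a higher order implies a lower one. -/
theorem OfOrder.mono_exponent (hω : IsControl a b ω) {r' : ℝ} (hr : 0 < r') (hrr : r' ≤ r)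
    (h : OfOrder a b ω r Ξ) : OfOrder a b ω r' Ξ := by
  rw [hω.ofOrder_iff] at h ⊢
  obtain ⟨C, hC, h⟩ := h
  -- the absolute value keeps the constant nonnegative when `b < a`, where `ω a b` is arbitrary
  refine ⟨C * |ω a b| ^ (r - r'), by positivity, fun s t h₁ h₂ h₃ => (h h₁ h₂ h₃).trans ?_⟩
  have h0 := hω.nonneg h₁ h₂ h₃
  have : ω s t ^ r = ω s t ^ (r - r') * ω s t ^ r' := by
    rw [← Real.rpow_add_of_nonneg h0 (by linarith) hr.le]; congr 1; ring
  rw [this, mul_assoc]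
  have h1 : ω s t ^ (r - r') ≤ |ω a b| ^ (r - r') :=
    Real.rpow_le_rpow h0 ((hω.mono le_rfl h₁ h₂ h₃ le_rfl).trans (le_abs_self _)) (by linarith)
  have := Real.rpow_nonneg h0 r'
  gcongr

theorem OfOrder.mul (hω : IsControl a b ω) {r' : ℝ} (hr : 0 ≤ r) (hr' : 0 ≤ r') {Ξ' : ℝ → ℝ → ℝ}
    (h : OfOrder a b ω r Ξ) (h' : OfOrder a b ω r' Ξ') :
    OfOrder a b ω (r + r') fun s t => Ξ s t * Ξ' s t :=
  IsBigO.congr' (IsBigO.mul h h') EventuallyEq.rfl <| eventually_principal.2 fun _ hz =>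
    (Real.rpow_add_of_nonneg (hω.nonneg hz.1 hz.2.1 hz.2.2) hr hr').symm

/-- A factor `f s`, where the increments of `f` are of positive order, preserves the order. -/
theorem OfOrder.mul_left_of_incr (h : OfOrder a b ω r Ξ) (hω : IsControl a b ω) {r' : ℝ}
    (hr : 0 ≤ r') {f : ℝ → ℝ} (hf : OfOrder a b ω r' fun s t => f t - f s) :
    OfOrder a b ω r fun s t => f s * Ξ s t := by
  rw [hω.ofOrder_iff] at h hf ⊢
  obtain ⟨C, hC, h⟩ := h
  obtain ⟨D, hD, hf⟩ := hf
  refine ⟨(|f a| + |D * ω a b ^ r'|) * C, by positivity, fun s t h₁ h₂ h₃ => ?_⟩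
  have e₁ : |f s| ≤ |f a| + |D * ω a b ^ r'| := by
    have e₂ := hf le_rfl h₁ (h₂.trans h₃)
    have e₃ : ω a s ^ r' ≤ ω a b ^ r' :=
      Real.rpow_le_rpow (hω.nonneg le_rfl h₁ (h₂.trans h₃))
        (hω.mono le_rfl le_rfl h₁ (h₂.trans h₃) le_rfl) hr
    have e₄ := mul_le_mul_of_nonneg_left e₃ hD
    have e₅ := le_abs_self (D * ω a b ^ r')
    have e₆ := abs_sub_abs_le_abs_sub (f s) (f a)
    linarith
  rw [abs_mul, mul_assoc]
  exact mul_le_mul e₁ (h h₁ h₂ h₃) (abs_nonneg _) (by positivity)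

/-- The sums of `ω ^ θ`, `θ > 1`, over the intervals of a partition tend to zero with the mesh. -/
theorem IsControl.exists_sum_rpow_lt (hω : IsControl a b ω) (hθ : 1 < θ) {ε : ℝ} (hε : 0 < ε) :
    ∃ δ > 0, ∀ (s t : ℝ) (n : ℕ) (u ξ : ℕ → ℝ), a ≤ s → t ≤ b →
      IsTaggedPartition s t δ n u ξ → ∑ i ∈ Finset.range n, ω (u i) (u (i + 1)) ^ θ < ε := by
  by_cases hab : a ≤ b
  swap
  · refine ⟨1, one_pos, fun s t n u ξ h₁ h₂ h => absurd ?_ hab⟩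
    have := h.mono (Nat.zero_le n)
    rw [h.left, h.right] at this
    linarith
  have hM : 0 ≤ ω a b := hω.nonneg le_rfl hab le_rfl
  -- on short intervals `ω ^ θ ≤ η * ω`, and `ω` sums to at most `ω a b` by superadditivity
  set η : ℝ := ε / (ω a b + 1)
  have hη : 0 < η := by positivity
  obtain ⟨δ, hδ, hs⟩ := hω.small (η ^ (1 / (θ - 1))) (by positivity)
  refine ⟨δ, hδ, fun s t n u ξ h₁ h₂ h => ?_⟩
  have hu : ∀ i ≤ n, a ≤ u i ∧ u i ≤ b := fun i hi =>
    ⟨h₁.trans (h.left ▸ h.mono (Nat.zero_le i)), le_trans (h.right ▸ h.mono hi) h₂⟩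
  have key : ∀ i < n, ω (u i) (u (i + 1)) ^ θ ≤ η * ω (u i) (u (i + 1)) := by
    intro i hi
    have h0 := hω.nonneg (hu i hi.le).1 (h.mono i.le_succ) (hu (i + 1) hi).2
    have h3 := hs (hu i hi.le).1 (h.mono i.le_succ) (hu (i + 1) hi).2 (h.mesh i hi)
    have h4 : ω (u i) (u (i + 1)) ^ (θ - 1) ≤ η := by
      calc _ ≤ (η ^ (1 / (θ - 1))) ^ (θ - 1) := Real.rpow_le_rpow h0 h3.le (by linarith)
        _ = η := by
          rw [← Real.rpow_mul hη.le, one_div_mul_cancel (by linarith), Real.rpow_one]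
    have h5 : ω (u i) (u (i + 1)) ^ θ = ω (u i) (u (i + 1)) ^ (θ - 1) * ω (u i) (u (i + 1)) := by
      rw [← Real.rpow_add_one' h0 (by linarith)]; congr 1; ring
    rw [h5]
    exact mul_le_mul_of_nonneg_right h4 h0
  have tot : ∀ m ≤ n, ∑ i ∈ Finset.range m, ω (u i) (u (i + 1)) ≤ ω (u 0) (u m) := by
    intro m
    induction m with
    | zero => intro _; simpa using hω.nonneg (hu 0 (Nat.zero_le n)).1 le_rfl (hu 0 (Nat.zero_le n)).2
    | succ m ih =>
      intro hm
      rw [Finset.sum_range_succ]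
      have := hω.superadd (hu 0 (Nat.zero_le n)).1 (h.mono (Nat.zero_le m)) (h.mono m.le_succ)
        (hu (m + 1) hm).2
      linarith [ih (Nat.le_of_succ_le hm)]
  have h6 : ω (u 0) (u n) ≤ ω a b :=
    hω.mono le_rfl (hu 0 (Nat.zero_le n)).1 (h.mono (Nat.zero_le n)) (hu n le_rfl).2 le_rfl
  calc _ ≤ ∑ i ∈ Finset.range n, η * ω (u i) (u (i + 1)) :=
        Finset.sum_le_sum fun i hi => key i (Finset.mem_range.1 hi)
    _ = η * ∑ i ∈ Finset.range n, ω (u i) (u (i + 1)) := (Finset.mul_sum _ _ _).symm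
    _ ≤ η * ω a b := mul_le_mul_of_nonneg_left ((tot n le_rfl).trans h6) hη.le
    _ < η * (ω a b + 1) := by gcongr; linarith
    _ = ε := div_mul_cancel₀ _ (by positivity)

/-- A function whose increments are of order `θ > 1` is constant. -/
theorem eq_of_ofOrder (hω : IsControl a b ω) (hθ : 1 < θ) {h : ℝ → ℝ}
    (hh : OfOrder a b ω θ fun s t => h t - h s) {t : ℝ} (hat : a ≤ t) (htb : t ≤ b) :
    h t = h a := by
  obtain ⟨C, hC, hh⟩ := hω.ofOrder_iff.1 hh
  by_contra hne
  have hpos : 0 < |h t - h a| := abs_pos.2 (sub_ne_zero.2 hne)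
  obtain ⟨δ, hδ, H⟩ := hω.exists_sum_rpow_lt hθ (ε := |h t - h a| / (C + 1)) (by positivity)
  obtain ⟨n, u, ξ, hp⟩ := exists_isTaggedPartition hat hδ
  have H := H a t n u ξ le_rfl htb hp
  have : |h t - h a| ≤ C * ∑ i ∈ Finset.range n, ω (u i) (u (i + 1)) ^ θ := by
    rw [← hp.left, ← hp.right, ← Finset.sum_range_sub (fun i => h (u i)), Finset.mul_sum]
    refine (Finset.abs_sum_le_sum_abs _ _).trans (Finset.sum_le_sum fun i hi => ?_)
    have hi := Finset.mem_range.1 hi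
    refine hh ?_ (hp.mono i.le_succ) ?_
    · rw [← hp.left]; exact hp.mono (Nat.zero_le i)
    · refine le_trans (hp.mono hi) ?_
      rw [hp.right]; exact htb
  rw [lt_div_iff₀ (by positivity)] at H
  have h0 : 0 ≤ ∑ i ∈ Finset.range n, ω (u i) (u (i + 1)) ^ θ := by
    by_contra hneg
    nlinarith
  nlinarith

/-- Discrete sewing lemma. The constant `2 C / (1 - 2 ^ (1 - θ))` is the fixed point of
`K ↦ 2 ^ (1 - θ) K + 2 C`: a string of indices is cut at the step which crosses half of its control,
so that each of the two outer strings carries at most half of it. -/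
theorem abs_sum_Ico_sub_le_of_superadditive {W Ξ : ℕ → ℕ → ℝ} {C : ℝ} (hC : 0 ≤ C) (hθ : 1 < θ)
    (hW : ∀ ⦃i j⦄, i ≤ j → 0 ≤ W i j)
    (hadd : ∀ ⦃i j k⦄, i ≤ j → j ≤ k → W i j + W j k ≤ W i k)
    (hΞ : ∀ ⦃i j k⦄, i ≤ j → j ≤ k → |Ξ i k - Ξ i j - Ξ j k| ≤ C * W i k ^ θ)
    {m n : ℕ} (hmn : m ≤ n) :
    |∑ i ∈ Finset.Ico m n, Ξ i (i + 1) - Ξ m n| ≤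
      2 * C / (1 - 2 ^ (1 - θ)) * W m n ^ θ := by
  set c : ℝ := 2 ^ (1 - θ)
  set K : ℝ := 2 * C / (1 - c)
  have hc1 : c < 1 := Real.rpow_lt_one_of_one_lt_of_neg one_lt_two (by linarith)
  have hK : c * K + 2 * C = K := by
    have : 1 - c ≠ 0 := by linarith
    simp only [K]; field_simp; ring
  have hself : ∀ i, W i i = 0 := fun i => by
    have := hadd (le_refl i) (le_refl i)
    have := hW (le_refl i)
    linarith
  obtain ⟨d, hd⟩ := Nat.exists_eq_add_of_le hmn
  induction d using Nat.strong_induction_on generalizing m n with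
  | _ d ih =>
  subst hd
  rcases Nat.eq_zero_or_pos d with rfl | hdpos
  · have h := hΞ (le_refl m) (le_refl m)
    rw [hself, Real.zero_rpow (by linarith), mul_zero] at h
    have h0 : Ξ m m = 0 := by
      have := abs_nonpos_iff.1 h
      linarith
    simp [h0, hself, Real.zero_rpow (show θ ≠ 0 by linarith)]
  have hWd := hW (Nat.le_add_right m d)
  have hhalf : 2 * (K * (W m (m + d) / 2) ^ θ) = c * K * W m (m + d) ^ θ := by
    rw [Real.div_rpow hWd (by norm_num)]
    have : (2 : ℝ) ^ θ * c = 2 := by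
      rw [← Real.rpow_add two_pos]; simp
    have h2 : (2 : ℝ) ^ θ ≠ 0 := by positivity
    field_simp
    linear_combination (-(K * W m (m + d) ^ θ)) * this
  -- `k` is the last step before which at most half of the control is used
  obtain ⟨k, hkd, hk, hk'⟩ : ∃ k < d, W m (m + k) ≤ W m (m + d) / 2 ∧
      W (m + k + 1) (m + d) ≤ W m (m + d) / 2 := by
    classical
    set S := (Finset.range d).filter fun k => W m (m + k) ≤ W m (m + d) / 2 with hSdef
    have hS : S.Nonempty := ⟨0, by
      simp only [S, Finset.mem_filter, Finset.mem_range, add_zero, hself]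
      exact ⟨hdpos, by linarith⟩⟩
    obtain ⟨l, hl, hmax⟩ := S.exists_max_image id hS
    rw [hSdef, Finset.mem_filter, Finset.mem_range] at hl
    refine ⟨l, hl.1, hl.2, ?_⟩
    by_cases hlt : l + 1 < d
    · have hnot : l + 1 ∉ S := fun h => absurd (hmax _ h) (by simp)
      rw [hSdef, Finset.mem_filter, Finset.mem_range, not_and, not_le] at hnot
      have h1 := hnot hlt
      have h2 := hadd (i := m) (j := m + l + 1) (k := m + d) (by omega) (by omega)
      rw [← add_assoc] at h1
      linarith
    · have : m + l + 1 = m + d := by omega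
      rw [this, hself]; linarith
  have hK0 : 0 ≤ K := div_nonneg (by linarith) (by linarith)
  have hA := ih k hkd (Nat.le_add_right m k) rfl
  have hB := ih (d - (k + 1)) (by omega) (show m + k + 1 ≤ m + d by omega) (by omega)
  have hA' : K * W m (m + k) ^ θ ≤ K * (W m (m + d) / 2) ^ θ :=
    mul_le_mul_of_nonneg_left (Real.rpow_le_rpow (hW (by omega)) hk (by linarith)) hK0
  have hB' : K * W (m + k + 1) (m + d) ^ θ ≤ K * (W m (m + d) / 2) ^ θ :=
    mul_le_mul_of_nonneg_left (Real.rpow_le_rpow (hW (by omega)) hk' (by linarith)) hK0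
  have h1 := hΞ (i := m) (j := m + k) (k := m + d) (by omega) (by omega)
  have h2 := hΞ (i := m + k) (j := m + k + 1) (k := m + d) (by omega) (by omega)
  have h3 : C * W (m + k) (m + d) ^ θ ≤ C * W m (m + d) ^ θ := by
    refine mul_le_mul_of_nonneg_left (Real.rpow_le_rpow (hW (by omega)) ?_ (by linarith)) hC
    have := hadd (i := m) (j := m + k) (k := m + d) (by omega) (by omega)
    have := hW (i := m) (j := m + k) (by omega)
    linarith
  have hsum : ∑ i ∈ Finset.Ico m (m + d), Ξ i (i + 1) =
      ∑ i ∈ Finset.Ico m (m + k), Ξ i (i + 1) + (Ξ (m + k) (m + k + 1) +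
        ∑ i ∈ Finset.Ico (m + k + 1) (m + d), Ξ i (i + 1)) := by
    rw [← Finset.sum_Ico_consecutive _ (Nat.le_add_right m k) (by omega : m + k ≤ m + d),
      Finset.sum_eq_sum_Ico_succ_bot (by omega : m + k < m + d)]
  rw [hsum, abs_le]
  rw [abs_le] at hA hB h1 h2
  have hfix : c * K * W m (m + d) ^ θ + 2 * (C * W m (m + d) ^ θ) = K * W m (m + d) ^ θ := by
    linear_combination W m (m + d) ^ θ * hK
  constructor <;> linarith

/-- Sewing along finitely many points: the function is the sum of `Ξ` over consecutive points. -/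
theorem IsControl.exists_sewing_finset (hω : IsControl a b ω) (hθ : 1 < θ) {C : ℝ} (hC : 0 ≤ C)
    (hΞ : ∀ ⦃s u t⦄, a ≤ s → s ≤ u → u ≤ t → t ≤ b →
      |Ξ s t - Ξ s u - Ξ u t| ≤ C * ω s t ^ θ) (S : Finset ℝ) :
    ∃ A : ℝ → ℝ, ∀ s ∈ S, ∀ t ∈ S, a ≤ s → s ≤ t → t ≤ b →
      |A t - A s - Ξ s t| ≤ 2 * C / (1 - 2 ^ (1 - θ)) * ω s t ^ θ := by
  classical
  set T := S.filter fun t => a ≤ t ∧ t ≤ b with hT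
  rcases T.eq_empty_or_nonempty with hemp | hne
  · refine ⟨fun _ => 0, fun s hs t _ h₁ h₂ h₃ => ?_⟩
    have : s ∈ T := Finset.mem_filter.2 ⟨hs, h₁, h₂.trans h₃⟩
    simp [hemp] at this
  have hcard : 0 < T.card := hne.card_pos
  -- the increasing enumeration of `T`, continued by its maximum
  set u : ℕ → ℝ := fun i => T.orderEmbOfFin rfl ⟨min i (T.card - 1), by omega⟩ with hu
  have humono : Monotone u := fun i j hij =>
    (T.orderEmbOfFin rfl).monotone (by simp only [Fin.mk_le_mk]; omega)
  have humem : ∀ i, a ≤ u i ∧ u i ≤ b := fun i =>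
    (Finset.mem_filter.1 (T.orderEmbOfFin_mem rfl _)).2
  have hex : ∀ t ∈ T, ∃ i, u i = t := fun t ht => by
    have : t ∈ Set.range (T.orderEmbOfFin rfl) := by
      rw [Finset.range_orderEmbOfFin]; exact ht
    obtain ⟨i, hi⟩ := this
    refine ⟨i, ?_⟩
    have e : (⟨min i (T.card - 1), by omega⟩ : Fin T.card) = i := Fin.ext (by simp only; omega)
    simp only [hu, e, hi]
  refine ⟨fun t => ∑ i ∈ Finset.range (Function.invFun u t), Ξ (u i) (u (i + 1)),
    fun s hs t ht h₁ h₂ h₃ => ?_⟩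
  have es : u (Function.invFun u s) = s :=
    Function.invFun_eq (hex s (Finset.mem_filter.2 ⟨hs, h₁, h₂.trans h₃⟩))
  have et : u (Function.invFun u t) = t :=
    Function.invFun_eq (hex t (Finset.mem_filter.2 ⟨ht, h₁.trans h₂, h₃⟩))
  have hle : Function.invFun u s ≤ Function.invFun u t := by
    rcases h₂.eq_or_lt with rfl | hlt
    · exact le_rfl
    · exact (humono.reflect_lt (by rw [es, et]; exact hlt)).le
  have := abs_sum_Ico_sub_le_of_superadditive (W := fun i j => ω (u i) (u j))
    (Ξ := fun i j => Ξ (u i) (u j)) hC hθ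
    (fun i j hij => hω.nonneg (humem i).1 (humono hij) (humem j).2)
    (fun i j k hij hjk => hω.superadd (humem i).1 (humono hij) (humono hjk) (humem k).2)
    (fun i j k hij hjk => hΞ (humem i).1 (humono hij) (humono hjk) (humem k).2) hle
  simp only [es, et] at this
  rwa [Finset.sum_Ico_eq_sub _ hle] at this

/-- Sewing lemma. The functions sewn along finite sets of points satisfy the estimate with the same
constant, so that they have a pointwise limit along an ultrafilter of finite sets of points. -/
theorem IsControl.exists_sewing (hω : IsControl a b ω) (hθ : 1 < θ) {C : ℝ} (hC : 0 ≤ C)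
    (hΞ : ∀ ⦃s u t⦄, a ≤ s → s ≤ u → u ≤ t → t ≤ b →
      |Ξ s t - Ξ s u - Ξ u t| ≤ C * ω s t ^ θ) :
    ∃ A : ℝ → ℝ, A a = 0 ∧ OfOrder a b ω θ fun s t => A t - A s - Ξ s t := by
  classical
  have hc1 : (2 : ℝ) ^ (1 - θ) < 1 := Real.rpow_lt_one_of_one_lt_of_neg one_lt_two (by linarith)
  set K : ℝ := 2 * C / (1 - 2 ^ (1 - θ))
  have hK0 : 0 ≤ K := div_nonneg (by linarith) (by linarith)
  choose A hA using fun S => hω.exists_sewing_finset hθ hC hΞ S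
  set U : Ultrafilter (Finset ℝ) := Ultrafilter.of atTop
  have hU : (U : Filter (Finset ℝ)) ≤ atTop := Ultrafilter.of_le _
  have hmem : ∀ t : ℝ, ∀ᶠ S in (U : Filter (Finset ℝ)), t ∈ S := fun t =>
    hU ((eventually_ge_atTop {t}).mono fun S hS => hS (Finset.mem_singleton_self t))
  have hlim : ∀ t : ℝ, ∃ l : ℝ, a ≤ t → t ≤ b →
      Tendsto (fun S => A S t - A S a) U (𝓝 l) := by
    intro t
    by_cases ht : a ≤ t ∧ t ≤ b
    swap
    · exact ⟨0, fun h₁ h₂ => absurd ⟨h₁, h₂⟩ ht⟩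
    have hmem' : ∀ᶠ S in (U : Filter (Finset ℝ)),
        A S t - A S a ∈ Icc (Ξ a t - K * ω a t ^ θ) (Ξ a t + K * ω a t ^ θ) := by
      filter_upwards [hmem a, hmem t] with S ha ht'
      have := abs_le.1 (hA S a ha t ht' le_rfl ht.1 ht.2)
      exact ⟨by linarith, by linarith⟩
    obtain ⟨l, -, hl⟩ := isCompact_Icc.ultrafilter_le_nhds (U.map fun S => A S t - A S a)
      (le_principal_iff.2 hmem')
    exact ⟨l, fun _ _ => hl⟩
  choose L hL using hlim
  refine ⟨fun t => L t - L a, sub_self _, hω.ofOrder_iff.2 ⟨K, hK0, fun s t h₁ h₂ h₃ => ?_⟩⟩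
  have ht := ((hL t (h₁.trans h₂) h₃).sub (hL s h₁ (h₂.trans h₃))).sub_const (Ξ s t)
  rw [sub_sub_sub_cancel_right]
  refine le_of_tendsto ht.abs ?_
  filter_upwards [hmem s, hmem t] with S hs ht
  have := hA S s hs t ht h₁ h₂ h₃
  rwa [sub_sub_sub_cancel_right]

end Control

/-! ### Young integration against a control -/

section Primitive

variable {a b : ℝ} {ω : ℝ → ℝ → ℝ} {r θ : ℝ}
  {E F G : Type*} [AddCommGroup E] [Module ℝ E] [AddCommGroup F] [Module ℝ F]
  [AddCommGroup G] [Module ℝ G]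

/-- Every linear functional of the increments of `f` is of order `r`. For finite-dimensional `E` this
says that `‖f t - f s‖ = O(ω s t ^ r)` in any norm. -/
def IncrOfOrder (a b : ℝ) (ω : ℝ → ℝ → ℝ) (r : ℝ) (f : ℝ → E) : Prop :=
  ∀ φ : Module.Dual ℝ E, OfOrder a b ω r fun s t => φ (f t - f s)

/-- `I` is a primitive of `B (f r) (dg r)`: the increment of `I` over `[s, t]` agrees with
`B (f s) (g t - g s)` up to order `θ`. For `θ > 1` this determines the increments of `I`. -/
def IsPrimitive (a b : ℝ) (ω : ℝ → ℝ → ℝ) (θ : ℝ) (B : E →ₗ[ℝ] F →ₗ[ℝ] G) (f : ℝ → E) (g : ℝ → F)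
    (I : ℝ → G) : Prop :=
  ∀ φ : Module.Dual ℝ G, OfOrder a b ω θ fun s t => φ (I t - I s - B (f s) (g t - g s))

theorem IncrOfOrder.comp {f : ℝ → E} (hf : IncrOfOrder a b ω r f) (φ : Module.Dual ℝ E) :
    OfOrder a b ω r fun s t => φ (f t) - φ (f s) := by
  simpa only [map_sub] using hf φ

/-- A product of two increments, over any two subintervals of `[s, t]`, is of order `θ`. -/
theorem IsControl.exists_bilin_incr_le [FiniteDimensional ℝ F] (hω : IsControl a b ω) (hθ : 0 < θ)
    (β : E →ₗ[ℝ] F →ₗ[ℝ] ℝ) {f : ℝ → E} {g : ℝ → F} (hf : IncrOfOrder a b ω (θ / 2) f)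
    (hg : IncrOfOrder a b ω (θ / 2) g) :
    ∃ C, 0 ≤ C ∧ ∀ ⦃s t⦄, a ≤ s → t ≤ b → ∀ ⦃u v u' v'⦄, s ≤ u → u ≤ v → v ≤ t →
      s ≤ u' → u' ≤ v' → v' ≤ t → |β (f v - f u) (g v' - g u')| ≤ C * ω s t ^ θ := by
  set e := Module.finBasis ℝ F
  choose C hC hf using fun i => hω.ofOrder_iff.1 (hf (β.flip (e i)))
  choose D hD hg using fun i => hω.ofOrder_iff.1 (hg (e.coord i))
  refine ⟨∑ i, C i * D i, Finset.sum_nonneg fun i _ => mul_nonneg (hC i) (hD i),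
    fun s t h₁ h₂ u v u' v' h₃ h₄ h₅ h₆ h₇ h₈ => ?_⟩
  have hst := hω.nonneg h₁ (h₃.trans (h₄.trans h₅)) h₂
  have hexp : β (f v - f u) (g v' - g u') =
      ∑ i, β.flip (e i) (f v - f u) * e.coord i (g v' - g u') := by
    conv_lhs => rw [← e.sum_repr (g v' - g u')]
    simp [mul_comm]
  have hsq : ω s t ^ θ = ω s t ^ (θ / 2) * ω s t ^ (θ / 2) := by
    rw [← Real.rpow_add_of_nonneg hst (by linarith) (by linarith), add_halves]
  have hle : ∀ ⦃u v⦄, s ≤ u → u ≤ v → v ≤ t → ω u v ^ (θ / 2) ≤ ω s t ^ (θ / 2) :=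
    fun u v hu huv hv => Real.rpow_le_rpow (hω.nonneg (h₁.trans hu) huv (hv.trans h₂))
      (hω.mono h₁ hu huv hv h₂) (by linarith)
  rw [hexp, Finset.sum_mul]
  refine (Finset.abs_sum_le_sum_abs _ _).trans (Finset.sum_le_sum fun i _ => ?_)
  rw [abs_mul, hsq, mul_mul_mul_comm]
  refine mul_le_mul ((hf i (h₁.trans h₃) h₄ (h₅.trans h₂)).trans ?_)
    ((hg i (h₁.trans h₆) h₇ (h₈.trans h₂)).trans ?_) (abs_nonneg _)
    (mul_nonneg (hC i) (Real.rpow_nonneg hst _))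
  · exact mul_le_mul_of_nonneg_left (hle h₃ h₄ h₅) (hC i)
  · exact mul_le_mul_of_nonneg_left (hle h₆ h₇ h₈) (hD i)

/-- Existence of Young integrals: each coordinate of the primitive is obtained by sewing. -/
theorem IsControl.exists_isPrimitive [FiniteDimensional ℝ F] [FiniteDimensional ℝ G]
    (hω : IsControl a b ω) (hθ : 1 < θ) (B : E →ₗ[ℝ] F →ₗ[ℝ] G) {f : ℝ → E} {g : ℝ → F}
    (hf : IncrOfOrder a b ω (θ / 2) f) (hg : IncrOfOrder a b ω (θ / 2) g) :
    ∃ I : ℝ → G, I a = 0 ∧ IsPrimitive a b ω θ B f g I := by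
  set e := Module.finBasis ℝ G
  have key : ∀ j, ∃ A : ℝ → ℝ, A a = 0 ∧
      OfOrder a b ω θ fun s t => A t - A s - e.coord j (B (f s) (g t - g s)) := by
    intro j
    obtain ⟨C, hC, h⟩ := hω.exists_bilin_incr_le (by linarith) (B.compr₂ (e.coord j)) hf hg
    refine hω.exists_sewing hθ hC (fun s u t h₁ h₂ h₃ h₄ => ?_)
    have := h h₁ h₄ le_rfl h₂ h₃ h₂ h₃ le_rfl
    rw [← abs_neg]
    convert! this using 2
    simp only [LinearMap.compr₂_apply, map_sub, LinearMap.sub_apply]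
    ring
  choose A hA0 hA using key
  refine ⟨fun t => ∑ j, A j t • e j, by simp [hA0], fun φ => ?_⟩
  refine (OfOrder.sum (S := Finset.univ) fun j _ => (hA j).const_mul (φ (e j))).congr
    fun s t _ _ _ => ?_
  have : φ (B (f s) (g t - g s)) = ∑ j, e.coord j (B (f s) (g t - g s)) * φ (e j) := by
    conv_lhs => rw [← e.sum_repr (B (f s) (g t - g s))]
    simp
  rw [map_sub φ, map_sub φ, this, map_sum, map_sum, ← Finset.sum_sub_distrib, ← Finset.sum_sub_distrib]
  refine Finset.sum_congr rfl fun j _ => ?_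
  simp only [map_smul, smul_eq_mul]
  ring

theorem IsPrimitive.incrOfOrder [FiniteDimensional ℝ F] (hω : IsControl a b ω) (hθ : 0 < θ)
    {B : E →ₗ[ℝ] F →ₗ[ℝ] G} {f : ℝ → E} {g : ℝ → F} {I : ℝ → G}
    (hI : IsPrimitive a b ω θ B f g I)
    (hf : IncrOfOrder a b ω (θ / 2) f) (hg : IncrOfOrder a b ω (θ / 2) g) :
    IncrOfOrder a b ω (θ / 2) I := by
  intro φ
  set e := Module.finBasis ℝ F
  have h₁ : OfOrder a b ω (θ / 2) fun s t =>
      ∑ i, φ (B (f s) (e i)) * e.coord i (g t - g s) :=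
    OfOrder.sum fun i _ => (hg (e.coord i)).mul_left_of_incr hω (by linarith : 0 ≤ θ / 2)
      (f := fun s => φ (B (f s) (e i))) (hf.comp (φ ∘ₗ B.flip (e i)))
  refine (((hI φ).mono_exponent hω (by linarith) (by linarith : θ / 2 ≤ θ)).add h₁).congr
    fun s t _ _ _ => ?_
  have : φ (B (f s) (g t - g s)) = ∑ i, φ (B (f s) (e i)) * e.coord i (g t - g s) := by
    conv_lhs => rw [← e.sum_repr (g t - g s)]
    simp [mul_comm]
  rw [← this, ← map_add, sub_add_cancel]

/-- The increments of a primitive are Young integrals. -/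
theorem IsPrimitive.hasYoungIntegral [FiniteDimensional ℝ F] (hω : IsControl a b ω) (hθ : 1 < θ)
    {B : E →ₗ[ℝ] F →ₗ[ℝ] G} {f : ℝ → E} {g : ℝ → F} {I : ℝ → G}
    (hI : IsPrimitive a b ω θ B f g I)
    (hf : IncrOfOrder a b ω (θ / 2) f) (hg : IncrOfOrder a b ω (θ / 2) g)
    {s t : ℝ} (has : a ≤ s) (htb : t ≤ b) :
    HasYoungIntegral B f g s t (I t - I s) := by
  intro φ ε hε
  obtain ⟨C, hC, hβ⟩ := hω.exists_bilin_incr_le (by linarith) (B.compr₂ φ) hf hg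
  obtain ⟨D, hD, hI⟩ := hω.ofOrder_iff.1 (hI φ)
  obtain ⟨δ, hδ, H⟩ := hω.exists_sum_rpow_lt hθ (ε := ε / (C + D + 1)) (by positivity)
  refine ⟨δ, hδ, fun n u ξ hp => ?_⟩
  have H := H s t n u ξ has htb hp
  have hau : ∀ i, a ≤ u i := fun i => has.trans (hp.left ▸ hp.mono (Nat.zero_le i))
  have hub : ∀ i ≤ n, u i ≤ b := fun i hi => le_trans (hp.right ▸ hp.mono hi) htb
  have key : |φ (youngSum B f g n u ξ) - φ (I t - I s)| ≤
      (C + D) * ∑ i ∈ Finset.range n, ω (u i) (u (i + 1)) ^ θ := by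
    rw [← hp.left, ← hp.right, ← Finset.sum_range_sub (fun i => I (u i)), youngSum, ← map_sub,
      ← Finset.sum_sub_distrib, map_sum, Finset.mul_sum]
    refine (Finset.abs_sum_le_sum_abs _ _).trans (Finset.sum_le_sum fun i hi => ?_)
    have hi := Finset.mem_range.1 hi
    have e₁ := hβ (hau i) (hub (i + 1) hi) le_rfl (hp.tag i hi).1 (hp.tag i hi).2 le_rfl
      (hp.mono i.le_succ) le_rfl
    have e₂ := hI (hau i) (hp.mono i.le_succ) (hub (i + 1) hi)
    have : φ (B (f (ξ i)) (g (u (i + 1)) - g (u i)) - (I (u (i + 1)) - I (u i))) =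
        B.compr₂ φ (f (ξ i) - f (u i)) (g (u (i + 1)) - g (u i)) -
          φ (I (u (i + 1)) - I (u i) - B (f (u i)) (g (u (i + 1)) - g (u i))) := by
      simp only [LinearMap.compr₂_apply, map_sub, LinearMap.sub_apply]
      ring
    rw [this, add_mul]
    exact (abs_sub _ _).trans (add_le_add e₁ e₂)
  rw [lt_div_iff₀ (by positivity)] at H
  have h0 : 0 ≤ ∑ i ∈ Finset.range n, ω (u i) (u (i + 1)) ^ θ :=
    Finset.sum_nonneg fun i hi => Real.rpow_nonneg (hω.nonneg (hau i) (hp.mono i.le_succ)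
      (hub (i + 1) (Finset.mem_range.1 hi))) _
  nlinarith

end Primitive

/-! ### The control of a path of finite variation -/

section PathControl

/-- The `p`-th power of the size of an increment of `x` is at most the increment of a function `v`, the
`p`-th power of the `p`-variation of `x` up to a given time. -/
theorem exists_pow_norm_sub_le {V : Type*} [NormedAddCommGroup V] {p a b : ℝ} (hp : 0 < p)
    {x : Icc a b → V}
    (hx : pVariation p x < ∞) :
    ∃ v : ℝ → ℝ, ∀ s t : Icc a b, s ≤ t → v s + ‖x t - x s‖ ^ p ≤ v t := by
  set T : ((ℕ × { u : ℕ → Icc a b // Monotone u }) → ℝ≥0∞) := fun q =>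
    ∑ i ∈ Finset.range q.1, ‖x (q.2.1 (i + 1)) - x (q.2.1 i)‖ₑ ^ p with hT
  set v : ℝ → ℝ≥0∞ := fun t => ⨆ q : {q : ℕ × { u : ℕ → Icc a b // Monotone u } //
    (q.2.1 q.1 : ℝ) ≤ t}, T q.1 with hv
  have htop : ∀ t, v t ≠ ∞ := fun t => by
    have h1 : ⨆ q, T q < ∞ := (ENNReal.rpow_lt_top_iff_of_pos (one_div_pos.2 hp)).1 hx
    exact ne_top_of_le_ne_top h1.ne (iSup_le fun q => le_iSup T q.1)
  have key : ∀ s t : Icc a b, s ≤ t → v s + ‖x t - x s‖ₑ ^ p ≤ v t := by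
    intro s t hst
    have : Nonempty {q : ℕ × { u : ℕ → Icc a b // Monotone u } // (q.2.1 q.1 : ℝ) ≤ s} :=
      ⟨⟨(0, ⟨fun _ => s, monotone_const⟩), le_rfl⟩⟩
    rw [hv]
    simp only
    rw [ENNReal.iSup_add]
    refine iSup_le ?_
    rintro ⟨⟨n, u, hu⟩, hn⟩
    have hn : u n ≤ s := hn
    -- the sequence `u` up to time `n`, followed by `s` and `t`
    set w : ℕ → Icc a b := fun i => if i ≤ n then u i else if i = n + 1 then s else t with hw
    have hwm : Monotone w := by
      refine monotone_nat_of_le_succ fun i => ?_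
      rcases lt_trichotomy i n with h | h | h
      · simp only [hw, h.le, Nat.succ_le_of_lt h, if_true]; exact hu i.le_succ
      · subst h; simp [hw, hn]
      · by_cases h' : i = n + 1
        · subst h'; simp [hw, hst]
        · simp [hw, h', show ¬ i ≤ n by omega, show ¬ i < n by omega, show i ≠ n by omega]
    have hle : T (n, ⟨u, hu⟩) + ‖x t - x s‖ₑ ^ p ≤ T (n + 2, ⟨w, hwm⟩) := by
      simp only [hT]
      rw [Finset.sum_range_succ, Finset.sum_range_succ]
      have e1 : ∑ i ∈ Finset.range n, ‖x (w (i + 1)) - x (w i)‖ₑ ^ p =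
          ∑ i ∈ Finset.range n, ‖x (u (i + 1)) - x (u i)‖ₑ ^ p :=
        Finset.sum_congr rfl fun i hi => by
          have := Finset.mem_range.1 hi
          simp [hw, this.le, Nat.succ_le_of_lt this]
      have e2 : w (n + 1 + 1) = t := by simp [hw]
      have e3 : w (n + 1) = s := by simp [hw]
      rw [e1, e2, e3]
      gcongr
      exact le_self_add
    refine hle.trans (le_iSup (fun q : {q : ℕ × { u : ℕ → Icc a b // Monotone u } //
      (q.2.1 q.1 : ℝ) ≤ t} => T q.1) ⟨(n + 2, ⟨w, hwm⟩), ?_⟩)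
    simp [hw]
  refine ⟨fun t => (v t).toReal, fun s t hst => ?_⟩
  have h := ENNReal.toReal_mono (htop t) (key s t hst)
  have hfin : ‖x t - x s‖ₑ ^ p ≠ ∞ := ENNReal.rpow_ne_top_of_nonneg hp.le enorm_ne_top
  rw [ENNReal.toReal_add (htop s) hfin, ← ENNReal.toReal_rpow, toReal_enorm] at h
  exact h

/-- A continuous path of finite `p`-variation is controlled with any exponent `1 / q < 1 / p`. The
control is `osc(x; [s, t]) ^ (q - p) * (v t - v s)`, where `v` is given by
`exists_pow_norm_sub_le`; the first factor makes it uniformly small on short intervals, so that the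
continuity of `v` is not needed. -/
theorem exists_isControl {V : Type*} [NormedAddCommGroup V] {p q a b : ℝ} (hp : 0 < p)
    (hpq : p < q) (hab : a ≤ b) {x : C(Icc a b, V)}
    (hx : pVariation p x < ∞) :
    ∃ ω, IsControl a b ω ∧ ∀ ⦃s t⦄, a ≤ s → s ≤ t → t ≤ b →
      ‖IccExtend hab x t - IccExtend hab x s‖ ^ q ≤ ω s t := by
  obtain ⟨v, hv⟩ := exists_pow_norm_sub_le hp hx
  set X : ℝ → V := IccExtend hab x
  have hX : Continuous X := x.continuous.Icc_extend'
  have hvX : ∀ ⦃s t⦄, a ≤ s → s ≤ t → t ≤ b → ‖X t - X s‖ ^ p ≤ v t - v s := by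
    intro s t h₁ h₂ h₃
    have := hv ⟨s, h₁, h₂.trans h₃⟩ ⟨t, h₁.trans h₂, h₃⟩ h₂
    simp only [X, IccExtend_of_mem hab x ⟨h₁, h₂.trans h₃⟩,
      IccExtend_of_mem hab x ⟨h₁.trans h₂, h₃⟩]
    linarith
  have hvm : ∀ ⦃s t⦄, a ≤ s → s ≤ t → t ≤ b → v s ≤ v t := fun s t h₁ h₂ h₃ => by
    have := hvX h₁ h₂ h₃
    have := Real.rpow_nonneg (norm_nonneg (X t - X s)) p
    linarith
  have hbdd : ∀ s t, Bornology.IsBounded (X '' Icc s t) := fun s t =>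
    (isCompact_Icc.image hX).isBounded
  have hq : 0 < q - p := by linarith
  refine ⟨fun s t => Metric.diam (X '' Icc s t) ^ (q - p) * (v t - v s), ⟨?_, ?_, ?_⟩, ?_⟩
  · intro s t h₁ h₂ h₃
    exact mul_nonneg (Real.rpow_nonneg Metric.diam_nonneg _) (sub_nonneg.2 (hvm h₁ h₂ h₃))
  · intro s u t h₁ h₂ h₃ h₄
    have e₁ : Metric.diam (X '' Icc s u) ^ (q - p) ≤ Metric.diam (X '' Icc s t) ^ (q - p) :=
      Real.rpow_le_rpow Metric.diam_nonneg
        (Metric.diam_mono (image_mono (Icc_subset_Icc_right h₃)) (hbdd _ _)) hq.le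
    have e₂ : Metric.diam (X '' Icc u t) ^ (q - p) ≤ Metric.diam (X '' Icc s t) ^ (q - p) :=
      Real.rpow_le_rpow Metric.diam_nonneg
        (Metric.diam_mono (image_mono (Icc_subset_Icc_left h₂)) (hbdd _ _)) hq.le
    have e₃ := mul_le_mul_of_nonneg_right e₁ (sub_nonneg.2 (hvm h₁ h₂ (h₃.trans h₄)))
    have e₄ := mul_le_mul_of_nonneg_right e₂ (sub_nonneg.2 (hvm (h₁.trans h₂) h₃ h₄))
    linarith
  · intro ε hε
    have hM : 0 ≤ v b - v a := sub_nonneg.2 (hvm le_rfl hab le_rfl)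
    set η : ℝ := (ε / (v b - v a + 1)) ^ (1 / (q - p))
    have hη : 0 < η := by positivity
    obtain ⟨δ, hδ, hu⟩ := Metric.uniformContinuousOn_iff.1
      (isCompact_Icc.uniformContinuousOn_of_continuous (s := Icc a b) hX.continuousOn) η hη
    refine ⟨δ, hδ, fun s t h₁ h₂ h₃ h₄ => ?_⟩
    have hd : Metric.diam (X '' Icc s t) ≤ η := by
      refine Metric.diam_le_of_forall_dist_le hη.le ?_
      rintro _ ⟨y, hy, rfl⟩ _ ⟨z, hz, rfl⟩
      refine (hu y ⟨h₁.trans hy.1, hy.2.trans h₃⟩ z ⟨h₁.trans hz.1, hz.2.trans h₃⟩ ?_).le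
      exact (Real.dist_le_of_mem_Icc hy hz).trans_lt h₄
    have hd' : Metric.diam (X '' Icc s t) ^ (q - p) ≤ ε / (v b - v a + 1) := by
      calc _ ≤ η ^ (q - p) := Real.rpow_le_rpow Metric.diam_nonneg hd hq.le
        _ = _ := by
          rw [← Real.rpow_mul (by positivity), one_div_mul_cancel hq.ne', Real.rpow_one]
    calc _ ≤ ε / (v b - v a + 1) * (v b - v a) := by
          refine mul_le_mul hd' ?_ (sub_nonneg.2 (hvm h₁ h₂ h₃)) (by positivity)
          have := hvm le_rfl h₁ (h₂.trans h₃)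
          have := hvm (h₁.trans h₂) h₃ le_rfl
          linarith
      _ < ε / (v b - v a + 1) * (v b - v a + 1) := by
          have : 0 < ε / (v b - v a + 1) := by positivity
          gcongr; linarith
      _ = ε := div_mul_cancel₀ _ (by positivity)
  · intro s t h₁ h₂ h₃
    have hd : ‖X t - X s‖ ≤ Metric.diam (X '' Icc s t) := by
      rw [← dist_eq_norm]
      exact Metric.dist_le_diam_of_mem (hbdd s t) (mem_image_of_mem _ ⟨h₂, le_rfl⟩)
        (mem_image_of_mem _ ⟨le_rfl, h₂⟩)
    calc ‖X t - X s‖ ^ q = ‖X t - X s‖ ^ (q - p) * ‖X t - X s‖ ^ p := by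
          rw [← Real.rpow_add_of_nonneg (norm_nonneg _) hq.le hp.le, sub_add_cancel]
      _ ≤ _ := mul_le_mul (Real.rpow_le_rpow (norm_nonneg _) hd hq.le) (hvX h₁ h₂ h₃)
          (Real.rpow_nonneg (norm_nonneg _) _) (Real.rpow_nonneg Metric.diam_nonneg _)

/-- The paths considered are controlled with an exponent `θ / 2 > 1 / 2`, since there is room for some
`q` with `p < q < 2`; here `q = (p + 2) / 2` and `θ = 2 / q`. -/
theorem exists_incrOfOrder {V : Type*} [NormedAddCommGroup V] [NormedSpace ℝ V]
    [FiniteDimensional ℝ V] {p a b : ℝ} (hp₁ : 1 ≤ p) (hp₂ : p < 2)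
    {hab : a ≤ b} (x : Path₀ V p hab) :
    ∃ ω θ, 1 < θ ∧ IsControl a b ω ∧ IncrOfOrder a b ω (θ / 2) (IccExtend hab x.1) := by
  obtain ⟨ω, hω, h⟩ := exists_isControl (q := (p + 2) / 2) (by linarith) (by linarith) hab x.2.1
  refine ⟨ω, 2 / ((p + 2) / 2), (one_lt_div (by linarith)).2 (by linarith), hω, fun φ => ?_⟩
  refine hω.ofOrder_iff.2 ⟨‖LinearMap.toContinuousLinearMap φ‖, norm_nonneg _,
    fun s t h₁ h₂ h₃ => ?_⟩
  refine ((LinearMap.toContinuousLinearMap φ).le_opNorm _).trans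
    (mul_le_mul_of_nonneg_left ?_ (norm_nonneg _))
  have hq : 0 < (p + 2) / 2 := by linarith
  have := Real.rpow_le_rpow (Real.rpow_nonneg (norm_nonneg _) _) (h h₁ h₂ h₃)
    (by positivity : 0 ≤ 1 / ((p + 2) / 2))
  rw [← Real.rpow_mul (norm_nonneg _), mul_one_div_cancel hq.ne', Real.rpow_one] at this
  rwa [show 2 / ((p + 2) / 2) / 2 = 1 / ((p + 2) / 2) by ring]

end PathControl

/-! ### Iterated integrals -/

section Iterated

variable {V : Type*} [AddCommGroup V] [Module ℝ V] [FiniteDimensional ℝ V]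
  {a b : ℝ} {ω : ℝ → ℝ → ℝ} {θ : ℝ} {x : ℝ → V}

/-- If the iterated integral at level `k` has increments of order `θ / 2`, then the Young integral
which defines the next level exists. -/
theorem iteratedIntegral_succ (hab : a ≤ b) (hω : IsControl a b ω) (hθ : 1 < θ)
    (hx : IncrOfOrder a b ω (θ / 2) x) {k : ℕ}
    (hk : IncrOfOrder a b ω (θ / 2) (iteratedIntegral x a k)) :
    iteratedIntegral x a (k + 1) a = 0 ∧ IsPrimitive a b ω θ (tensorSnoc k)
      (iteratedIntegral x a k) x (iteratedIntegral x a (k + 1)) := by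
  obtain ⟨I, hI0, hI⟩ := hω.exists_isPrimitive hθ (tensorSnoc k) hk hx
  have key : ∀ t, a ≤ t → t ≤ b → iteratedIntegral x a (k + 1) t = I t := fun t h₁ h₂ => by
    have := (hI.hasYoungIntegral hω hθ hk hx le_rfl h₂).youngIntegral_eq h₁
    rwa [hI0, sub_zero] at this
  refine ⟨(key a le_rfl hab).trans hI0, fun φ => (hI φ).congr fun s t h₁ h₂ h₃ => ?_⟩
  rw [key s h₁ (h₂.trans h₃), key t (h₁.trans h₂) h₃]

theorem incrOfOrder_iteratedIntegral (hab : a ≤ b) (hω : IsControl a b ω) (hθ : 1 < θ)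
    (hx : IncrOfOrder a b ω (θ / 2) x) (k : ℕ) :
    IncrOfOrder a b ω (θ / 2) (iteratedIntegral x a k) := by
  induction k with
  | zero =>
    intro φ
    simpa only [iteratedIntegral, sub_self, map_zero] using OfOrder.zero
  | succ k ih =>
    exact (iteratedIntegral_succ hab hω hθ hx ih).2.incrOfOrder hω (by linarith) ih hx

end Iterated

/-! ### Words in linear functionals -/

section Words

variable {V : Type*} [AddCommGroup V] [Module ℝ V]

/-- Right multiplication by a linear functional on the tensor algebra `T(V*)`. -/
noncomputable def snocDual (ψ : Module.Dual ℝ V) : CoTensor V →ₗ[ℝ] CoTensor V :=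
  DirectSum.toModule ℝ ℕ _ fun k =>
    DirectSum.lof ℝ ℕ (fun k => ⨂[ℝ]^k (Module.Dual ℝ V)) (k + 1) ∘ₗ (tensorSnoc k).flip ψ

theorem snocDual_lof (ψ : Module.Dual ℝ V) (k : ℕ) (f : ⨂[ℝ]^k (Module.Dual ℝ V)) :
    snocDual ψ (DirectSum.lof ℝ ℕ (fun k => ⨂[ℝ]^k (Module.Dual ℝ V)) k f) =
      DirectSum.lof ℝ ℕ (fun k => ⨂[ℝ]^k (Module.Dual ℝ V)) (k + 1) (tensorSnoc k f ψ) := by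
  rw [snocDual, DirectSum.toModule_lof]
  rfl

/-- The elementary tensor `φ_k ⊗ ⋯ ⊗ φ₁` of a list `[φ₁, …, φ_k]` of linear functionals. The order is
reversed because the iterated integrals are built by adding factors on the right. -/
noncomputable def word : List (Module.Dual ℝ V) → CoTensor V
  | [] => DirectSum.lof ℝ ℕ (fun k => ⨂[ℝ]^k (Module.Dual ℝ V)) 0
      (PiTensorProduct.tprod ℝ Fin.elim0)
  | ψ :: l => snocDual ψ (word l)

theorem lof_tprod_mem_range_word (k : ℕ) (f : Fin k → Module.Dual ℝ V) :
    DirectSum.lof ℝ ℕ (fun k => ⨂[ℝ]^k (Module.Dual ℝ V)) k (PiTensorProduct.tprod ℝ f) ∈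
      Set.range (word (V := V)) := by
  induction k with
  | zero => exact ⟨[], by rw [word, Subsingleton.elim f Fin.elim0]⟩
  | succ k ih =>
    obtain ⟨l, hl⟩ := ih (Fin.init f)
    refine ⟨f (Fin.last k) :: l, ?_⟩
    rw [word, hl, snocDual_lof, tensorSnoc_tprod, Fin.snoc_init_self]

theorem span_range_word : Submodule.span ℝ (Set.range (word (V := V))) = ⊤ := by
  rw [eq_top_iff]
  rintro h -
  induction h using DirectSum.induction_on with
  | zero => exact Submodule.zero_mem _
  | add f g hf hg => exact Submodule.add_mem _ hf hg
  | of k f =>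
    have hf : f ∈ Submodule.span ℝ (Set.range
        (PiTensorProduct.tprod ℝ (s := fun _ : Fin k => Module.Dual ℝ V))) := by
      rw [PiTensorProduct.span_tprod_eq_top]; trivial
    change DirectSum.lof ℝ ℕ (fun k => ⨂[ℝ]^k (Module.Dual ℝ V)) k f ∈ _
    induction hf using Submodule.span_induction with
    | mem f hf =>
      obtain ⟨f, rfl⟩ := hf
      exact Submodule.subset_span (lof_tprod_mem_range_word k f)
    | zero => rw [map_zero]; exact Submodule.zero_mem _
    | add f g _ _ hf hg => rw [map_add]; exact Submodule.add_mem _ hf hg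
    | smul c f _ hf => rw [map_smul]; exact Submodule.smul_mem _ c hf

theorem pairingDual_tensorSnoc {k : ℕ} (f : ⨂[ℝ]^k (Module.Dual ℝ V)) (ψ : Module.Dual ℝ V)
    (A : ⨂[ℝ]^k V) (v : V) :
    TensorPower.pairingDual ℝ V (k + 1) (tensorSnoc k f ψ) (tensorSnoc k A v) =
      TensorPower.pairingDual ℝ V k f A * ψ v := by
  induction f using PiTensorProduct.induction_on with
  | add f g hf hg => simp only [map_add, LinearMap.add_apply, hf, hg, add_mul]
  | smul_tprod c f =>
    induction A using PiTensorProduct.induction_on with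
    | add A B hA hB => simp only [map_add, LinearMap.add_apply, hA, hB, add_mul]
    | smul_tprod d A =>
      simp only [map_smul, LinearMap.smul_apply, tensorSnoc_tprod,
        TensorPower.pairingDual_tprod_tprod, Fin.prod_univ_castSucc, Fin.snoc_castSucc,
        Fin.snoc_last, smul_eq_mul, mul_assoc]

/-- In finite dimension `(V*)^{⊗k}` is the whole dual space of `V^{⊗k}`. -/
theorem pairingDual_surjective [FiniteDimensional ℝ V] (k : ℕ) :
    Function.Surjective (TensorPower.pairingDual ℝ V k) := by
  have : TensorPower.pairingDual ℝ V k =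
      (PiTensorProduct.dualDistribEquiv (R := ℝ) (M := fun _ : Fin k => V)).toLinearMap := by
    ext f v
    exact (TensorPower.pairingDual_tprod_tprod f v).trans
      (PiTensorProduct.dualDistrib_apply f v).symm
  rw [this]
  exact LinearEquiv.surjective _

/-- Tensor polynomials over `V*` separate the points of `T((V))`. -/
theorem exists_pairing_ne [FiniteDimensional ℝ V] {A B : TensorSeries V} (h : A ≠ B) :
    ∃ f : CoTensor V, pairing f A ≠ pairing f B := by
  obtain ⟨k, hk⟩ := Function.ne_iff.1 h
  obtain ⟨φ, hφ⟩ : ∃ φ : Module.Dual ℝ (⨂[ℝ]^k V), φ (A k - B k) ≠ 0 := by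
    by_contra! hall
    exact hk (sub_eq_zero.1 ((Module.forall_dual_apply_eq_zero_iff ℝ _).1 hall))
  obtain ⟨f, rfl⟩ := pairingDual_surjective k φ
  refine ⟨DirectSum.lof ℝ ℕ (fun k => ⨂[ℝ]^k (Module.Dual ℝ V)) k f, ?_⟩
  rw [pairing_of, pairing_of]
  rwa [map_sub, sub_ne_zero] at hφ

end Words

/-! ### The shuffle identity -/

section Shuffle

variable {V : Type*} [AddCommGroup V] [Module ℝ V]

/-- The pairing of `f ∈ T(V*)` with the signature of `x` over `[a, t]`. -/
noncomputable def sigPairing (x : ℝ → V) (a : ℝ) (f : CoTensor V) (t : ℝ) : ℝ :=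
  pairing f fun k => iteratedIntegral x a k t

theorem sigPairing_add (x : ℝ → V) (a : ℝ) (f g : CoTensor V) (t : ℝ) :
    sigPairing x a (f + g) t = sigPairing x a f t + sigPairing x a g t := by
  simp only [sigPairing, map_add, LinearMap.add_apply]

theorem sigPairing_smul (x : ℝ → V) (a c : ℝ) (f : CoTensor V) (t : ℝ) :
    sigPairing x a (c • f) t = c * sigPairing x a f t := by
  simp only [sigPairing, map_smul, LinearMap.smul_apply, smul_eq_mul]

theorem sigPairing_zero (x : ℝ → V) (a t : ℝ) : sigPairing x a 0 t = 0 := by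
  simp only [sigPairing, map_zero, LinearMap.zero_apply]

theorem sigPairing_lof (x : ℝ → V) (a : ℝ) (k : ℕ) (f : ⨂[ℝ]^k (Module.Dual ℝ V)) (t : ℝ) :
    sigPairing x a (DirectSum.lof ℝ ℕ (fun k => ⨂[ℝ]^k (Module.Dual ℝ V)) k f) t =
      TensorPower.pairingDual ℝ V k f (iteratedIntegral x a k t) :=
  pairing_of _ _ _

theorem sigPairing_word_nil (x : ℝ → V) (a t : ℝ) : sigPairing x a (word []) t = 1 := by
  rw [word, sigPairing_lof]
  simp [iteratedIntegral]

variable [FiniteDimensional ℝ V] {a b : ℝ} {ω : ℝ → ℝ → ℝ} {θ : ℝ} {x : ℝ → V}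

theorem ofOrder_sigPairing (hab : a ≤ b) (hω : IsControl a b ω) (hθ : 1 < θ)
    (hx : IncrOfOrder a b ω (θ / 2) x) (f : CoTensor V) :
    OfOrder a b ω (θ / 2) fun s t => sigPairing x a f t - sigPairing x a f s := by
  induction f using DirectSum.induction_on with
  | zero => simpa only [sigPairing_zero, sub_self] using OfOrder.zero
  | of k f =>
    refine ((incrOfOrder_iteratedIntegral hab hω hθ hx k).comp
      (TensorPower.pairingDual ℝ V k f)).congr fun s t _ _ _ => ?_
    exact congrArg₂ _ (sigPairing_lof x a k f t).symm (sigPairing_lof x a k f s).symm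
  | add f g hf hg =>
    refine (hf.add hg).congr fun s t _ _ _ => ?_
    rw [sigPairing_add, sigPairing_add]; ring

theorem sigPairing_snocDual_left (hab : a ≤ b) (hω : IsControl a b ω) (hθ : 1 < θ)
    (hx : IncrOfOrder a b ω (θ / 2) x) (ψ : Module.Dual ℝ V) (f : CoTensor V) :
    sigPairing x a (snocDual ψ f) a = 0 := by
  induction f using DirectSum.induction_on with
  | zero => rw [map_zero, sigPairing_zero]
  | of k f =>
    refine (congrArg (sigPairing x a · a) (snocDual_lof ψ k f)).trans ?_
    rw [sigPairing_lof, (iteratedIntegral_succ hab hω hθ hx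
      (incrOfOrder_iteratedIntegral hab hω hθ hx k)).1, map_zero]
  | add f g hf hg => rw [map_add, sigPairing_add, hf, hg, add_zero]

/-- In differential form: `d(f ⊗ ψ, S(x)) = (f, S(x)) d(ψ ∘ x)`. -/
theorem ofOrder_sigPairing_snocDual (hab : a ≤ b) (hω : IsControl a b ω) (hθ : 1 < θ)
    (hx : IncrOfOrder a b ω (θ / 2) x) (ψ : Module.Dual ℝ V) (f : CoTensor V) :
    OfOrder a b ω θ fun s t => sigPairing x a (snocDual ψ f) t - sigPairing x a (snocDual ψ f) s -
      sigPairing x a f s * ψ (x t - x s) := by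
  induction f using DirectSum.induction_on with
  | zero => simpa only [map_zero, sigPairing_zero, sub_self, zero_mul] using OfOrder.zero
  | of k f =>
    refine ((iteratedIntegral_succ hab hω hθ hx (incrOfOrder_iteratedIntegral hab hω hθ hx k)).2
      (TensorPower.pairingDual ℝ V (k + 1) (tensorSnoc k f ψ))).congr fun s t _ _ _ => ?_
    change _ = sigPairing x a (snocDual ψ (DirectSum.lof ℝ ℕ _ k f)) t -
      sigPairing x a (snocDual ψ (DirectSum.lof ℝ ℕ _ k f)) s -
        sigPairing x a (DirectSum.lof ℝ ℕ _ k f) s * _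
    rw [snocDual_lof, sigPairing_lof, sigPairing_lof, sigPairing_lof, ← pairingDual_tensorSnoc,
      map_sub, map_sub]
  | add f g hf hg =>
    refine (hf.add hg).congr fun s t _ _ _ => ?_
    rw [map_add, sigPairing_add, sigPairing_add, sigPairing_add]; ring

/-- The recursion of the shuffle product: if `h₁` represents the product of `f ⊗ φ` and `g`, and `h₂`
that of `f` and `g ⊗ ψ`, then `h₁ ⊗ ψ + h₂ ⊗ φ` represents the product of `f ⊗ φ` and `g ⊗ ψ`. This is
the Leibniz rule, as the product of two increments is of order `θ > 1`. -/
theorem sigPairing_mul_snocDual (hab : a ≤ b) (hω : IsControl a b ω) (hθ : 1 < θ)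
    (hx : IncrOfOrder a b ω (θ / 2) x) {φ ψ : Module.Dual ℝ V} {f g h₁ h₂ : CoTensor V}
    (H₁ : ∀ t, a ≤ t → t ≤ b →
      sigPairing x a (snocDual φ f) t * sigPairing x a g t = sigPairing x a h₁ t)
    (H₂ : ∀ t, a ≤ t → t ≤ b →
      sigPairing x a f t * sigPairing x a (snocDual ψ g) t = sigPairing x a h₂ t)
    {t : ℝ} (hat : a ≤ t) (htb : t ≤ b) :
    sigPairing x a (snocDual φ f) t * sigPairing x a (snocDual ψ g) t =
      sigPairing x a (snocDual ψ h₁ + snocDual φ h₂) t := by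
  have hθ' : 0 ≤ θ / 2 := by linarith
  have hf := ofOrder_sigPairing hab hω hθ hx (snocDual φ f)
  have hg := ofOrder_sigPairing hab hω hθ hx (snocDual ψ g)
  have e₁ := (ofOrder_sigPairing_snocDual hab hω hθ hx ψ g).mul_left_of_incr hω hθ' hf
  have e₂ := (ofOrder_sigPairing_snocDual hab hω hθ hx φ f).mul_left_of_incr hω hθ' hg
  have e₃ := OfOrder.mul hω hθ' hθ' hf hg
  rw [add_halves] at e₃
  have e₄ := (ofOrder_sigPairing_snocDual hab hω hθ hx ψ h₁).add
    (ofOrder_sigPairing_snocDual hab hω hθ hx φ h₂)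
  have hD := eq_of_ofOrder hω hθ (h := fun t =>
    sigPairing x a (snocDual φ f) t * sigPairing x a (snocDual ψ g) t -
      sigPairing x a (snocDual ψ h₁ + snocDual φ h₂) t)
    ((((e₁.add e₂).add e₃).sub e₄).congr fun s t h₁ h₂ h₃ => by
      have E₁ := H₁ s h₁ (h₂.trans h₃)
      have E₂ := H₂ s h₁ (h₂.trans h₃)
      simp only [sigPairing_add]
      linear_combination (-ψ (x t - x s)) * E₁ - φ (x t - x s) * E₂) hat htb
  simp only [sigPairing_add, sigPairing_snocDual_left hab hω hθ hx] at hD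
  rw [sigPairing_add]
  linarith

end Shuffle

/-! ### Density of the coordinates of the signature -/

section Path

variable {V : Type*} [NormedAddCommGroup V] [NormedSpace ℝ V] [FiniteDimensional ℝ V]
  {p a b : ℝ} {hab : a ≤ b}

/-- The representing element `h` does not depend on the path, although the control does. -/
theorem exists_sigPairing_mul_word (hp₁ : 1 ≤ p) (hp₂ : p < 2) (l m : List (Module.Dual ℝ V)) :
    ∃ h : CoTensor V, ∀ (x : Path₀ V p hab) (t : ℝ), a ≤ t → t ≤ b →
      sigPairing (IccExtend hab x.1) a (word l) t * sigPairing (IccExtend hab x.1) a (word m) t =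
        sigPairing (IccExtend hab x.1) a h t := by
  induction l generalizing m with
  | nil => exact ⟨word m, fun x t _ _ => by rw [sigPairing_word_nil, one_mul]⟩
  | cons φ l ihl =>
    induction m with
    | nil => exact ⟨word (φ :: l), fun x t _ _ => by rw [sigPairing_word_nil, mul_one]⟩
    | cons ψ m ihm =>
      obtain ⟨h₁, H₁⟩ := ihm
      obtain ⟨h₂, H₂⟩ := ihl (ψ :: m)
      refine ⟨snocDual ψ h₁ + snocDual φ h₂, fun x t hat htb => ?_⟩
      obtain ⟨ω, θ, hθ, hω, hx⟩ := exists_incrOfOrder hp₁ hp₂ x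
      exact sigPairing_mul_snocDual hab hω hθ hx (H₁ x) (H₂ x) hat htb

/-- A product of two coordinates of the signature is again a coordinate of the signature. -/
theorem exists_pairing_signature_mul (hp₁ : 1 ≤ p) (hp₂ : p < 2) (f g : CoTensor V) :
    ∃ h : CoTensor V, ∀ x : Path₀ V p hab,
      pairing f (signature x) * pairing g (signature x) = pairing h (signature x) := by
  have hf : f ∈ Submodule.span ℝ (Set.range (word (V := V))) := by
    rw [span_range_word]; trivial
  have hg : g ∈ Submodule.span ℝ (Set.range (word (V := V))) := by
    rw [span_range_word]; trivial
  induction hf using Submodule.span_induction with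
  | mem f hf =>
    obtain ⟨l, rfl⟩ := hf
    induction hg using Submodule.span_induction with
    | mem g hg =>
      obtain ⟨m, rfl⟩ := hg
      obtain ⟨h, hh⟩ := exists_sigPairing_mul_word (hab := hab) hp₁ hp₂ l m
      exact ⟨h, fun x => hh x b hab le_rfl⟩
    | zero => exact ⟨0, fun x => by simp⟩
    | add g g' _ _ hg hg' =>
      obtain ⟨h, hh⟩ := hg
      obtain ⟨h', hh'⟩ := hg'
      exact ⟨h + h', fun x => by simp only [map_add, LinearMap.add_apply, mul_add, hh, hh']⟩
    | smul c g _ hg =>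
      obtain ⟨h, hh⟩ := hg
      exact ⟨c • h, fun x => by
        simp only [map_smul, LinearMap.smul_apply, smul_eq_mul, ← hh]; ring⟩
  | zero => exact ⟨0, fun x => by simp⟩
  | add f f' _ _ hf hf' =>
    obtain ⟨h, hh⟩ := hf
    obtain ⟨h', hh'⟩ := hf'
    exact ⟨h + h', fun x => by simp only [map_add, LinearMap.add_apply, add_mul, hh, hh']⟩
  | smul c f _ hf =>
    obtain ⟨h, hh⟩ := hf
    exact ⟨c • h, fun x => by
      simp only [map_smul, LinearMap.smul_apply, smul_eq_mul, ← hh]; ring⟩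

/-- The coordinates of the signature, as continuous functions on a set `K` of unparameterised paths,
form a subalgebra of `C(K, ℝ)`. -/
noncomputable def sigSubalgebra (hp₁ : 1 ≤ p) (hp₂ : p < 2) [TopologicalSpace (UnparamPath V p hab)]
    (K : Set (UnparamPath V p hab))
    (hcont : ∀ f : CoTensor V, Continuous fun γ : K => sigFunctional f (γ : UnparamPath V p hab)) :
    Subalgebra ℝ C(K, ℝ) where
  carrier := Set.range fun f : CoTensor V =>
    (⟨fun γ : K => sigFunctional f (γ : UnparamPath V p hab), hcont f⟩ : C(K, ℝ))
  mul_mem' := by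
    rintro _ _ ⟨f, rfl⟩ ⟨g, rfl⟩
    obtain ⟨h, hh⟩ := exists_pairing_signature_mul (hab := hab) hp₁ hp₂ f g
    refine ⟨h, ContinuousMap.ext ?_⟩
    rintro ⟨⟨x⟩, -⟩
    exact (hh x).symm
  add_mem' := by
    rintro _ _ ⟨f, rfl⟩ ⟨g, rfl⟩
    refine ⟨f + g, ContinuousMap.ext ?_⟩
    rintro ⟨⟨x⟩, -⟩
    exact sigPairing_add (IccExtend hab x.1) a f g b
  algebraMap_mem' c := by
    refine ⟨c • word [], ContinuousMap.ext ?_⟩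
    rintro ⟨⟨x⟩, -⟩
    refine (sigPairing_smul (IccExtend hab x.1) a c (word []) b).trans ?_
    rw [sigPairing_word_nil, mul_one]
    rfl

end Path

end PathSignature

theorem mainTheorem1 {V : Type*} [NormedAddCommGroup V] [NormedSpace ℝ V] [FiniteDimensional ℝ V]
    {p : ℝ} (hp₁ : 1 ≤ p) (hp₂ : p < 2) {a b : ℝ} (hab : a ≤ b)
    [TopologicalSpace (PathSignature.UnparamPath V p hab)]
    (K : Set (PathSignature.UnparamPath V p hab)) (hK : IsCompact K)
    (hcont : ∀ f : PathSignature.CoTensor V,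
      Continuous fun γ : K => PathSignature.sigFunctional f (γ : PathSignature.UnparamPath V p hab)) :
    Dense (Set.range fun f : PathSignature.CoTensor V =>
      (⟨fun γ : K => PathSignature.sigFunctional f (γ : PathSignature.UnparamPath V p hab),
        hcont f⟩ : C(K, ℝ))) := by
  have : CompactSpace K := isCompact_iff_compactSpace.1 hK
  have hsep : (PathSignature.sigSubalgebra hp₁ hp₂ K hcont).SeparatesPoints := by
    rintro ⟨⟨x⟩, hx⟩ ⟨⟨y⟩, hy⟩ hne
    have hS : PathSignature.signature x ≠ PathSignature.signature y := fun h =>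
      hne (Subtype.ext (Quotient.sound h))
    obtain ⟨f, hf⟩ := PathSignature.exists_pairing_ne hS
    exact ⟨_, ⟨_, ⟨f, rfl⟩, rfl⟩, hf⟩
  have h := ContinuousMap.subalgebra_topologicalClosure_eq_top_of_separatesPoints _ hsep
  exact dense_iff_closure_eq.2 (congrArg SetLike.coe h)
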